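/- Let $\mathcal H\neq 0$ and $\mathcal H_1,\dots,\mathcal H_n$ be finite-dimensional complex Hilbert spaces, let $N=\{1,\dots,n\}$, and for $X\subseteq N$ put $\mathcal H_X=\bigotimes_{i\in X}\mathcal H_i$ (so $\mathcal H_\emptyset=\mathbb C$). A \emph{quantum operation} is a completely positive trace preserving linear map, and $\mathcal S(\cdot)$ denotes the set of density operators. A \emph{quantum secret sharing (QSS) scheme} is a quantum operation $W_N$ from $\mathcal H$ to $\mathcal H_N$ for which there is a quantum operation $R$ from $\mathcal H_N$ to $\mathcal H$ with $R(W_N(\rho))=\rho$ for all $\rho\in\mathcal S(\mathcal H)$. For $X\subseteq N$ let $W_X=\operatorname{Tr}_{N\setminus X}\circ W_N$. The set $X$ is \emph{qualified} if there is a quantum operation $R$ from $\mathcal H_X$ to $\mathcal H$ with $R(W_X(\rho))=\rho$ for all $\rho\in\mathcal S(\mathcal H)$, and \emph{forbidden} if there is $\rho_0\in\mathcal S(\mathcal H_X)$ with $W_X(\rho)=\rho_0$ for all $\rho\in\mathcal S(\mathcal H)$. For integers $k,L\ge 0$ the scheme is a \emph{$(k,L,n)$-threshold ramp QSS scheme}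 if, for every $X\subseteq N$, $X$ is forbidden if and only if $|X|\le k-L$, and $X$ is qualified if and only if $|X|\ge k$. It is a \emph{pure state scheme} if $W_N(\rho)$ is a pure state for every pure state $\rho$. Every $(k,L,n)$-threshold ramp QSS scheme satisfies $n\le 2k-L$. If it is moreover a pure state scheme, then $n=2k-L$. -/

import Mathlib

open scoped ComplexOrder CStarAlgebra MatrixOrder Matrix.Norms.L2Operator

/-!
Conventions. A finite-dimensional Hilbert space with a chosen orthonormal basis indexed by a finite
type `d` is `ℂ^d`, and its linear operators are the matrices `Matrix d d ℂ`, a C*-algebra under the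
operator norm, ordered by positive semidefiniteness. The tensor product of the spaces `ℂ^(κ i)`,
`i ∈ I`, has the product basis, which is indexed by `∀ i : I, κ i`.
-/

namespace RampQSS

/-- The density operators on `ℂ^d`: the positive semidefinite operators of trace one. -/
def densityOperators (d : Type*) [Fintype d] : Set (Matrix d d ℂ) :=
  {ρ | ρ.PosSemidef ∧ ρ.trace = 1}

/-- The pure states on `ℂ^d`: the operators `|ψ⟩⟨ψ|` with `ψ` a unit vector. -/
def pureStates (d : Type*) [Fintype d] : Set (Matrix d d ℂ) :=
  {ρ | ∃ ψ : EuclideanSpace ℂ d, ‖ψ‖ = 1 ∧ ρ = Matrix.of fun a b => ψ a * star (ψ b)}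

/-- A quantum operation from `ℂ^d` to `ℂ^e`: a completely positive, trace preserving linear map. -/
structure QuantumOperation (d e : Type*) [Fintype d] [DecidableEq d] [Fintype e]
    [DecidableEq e] extends Matrix d d ℂ →CP Matrix e e ℂ where
  trace_map : ∀ A : Matrix d d ℂ, (toLinearMap A).trace = A.trace

section Channels

variable {d e : Type*} [Fintype d] [DecidableEq d] [Fintype e] [DecidableEq e]

/-- `E` is reversible with respect to `S`: some quantum operation undoes `E` on `S`. -/
def IsReversible (E : Matrix d d ℂ →ₗ[ℂ] Matrix e e ℂ) (S : Set (Matrix d d ℂ)) : Prop :=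
  ∃ R : QuantumOperation e d, ∀ ρ ∈ S, R.toLinearMap (E ρ) = ρ

/-- `E` is vanishing with respect to `S`: it sends all of `S` to one and the same density
operator. -/
def IsVanishing (E : Matrix d d ℂ →ₗ[ℂ] Matrix e e ℂ) (S : Set (Matrix d d ℂ)) : Prop :=
  ∃ ρ₀ ∈ densityOperators e, ∀ ρ ∈ S, E ρ = ρ₀

/-- `E` sends pure states to pure states. -/
def IsPureStateChannel (E : Matrix d d ℂ →ₗ[ℂ] Matrix e e ℂ) : Prop :=
  ∀ ρ ∈ pureStates d, E ρ ∈ pureStates e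

end Channels

section Shares

variable {ι : Type*} [Fintype ι] [DecidableEq ι]
  {κ : ι → Type*} [∀ i, Fintype (κ i)] [∀ i, DecidableEq (κ i)]

/-- The basis index of the whole system whose part in `X` is `a` and whose part in the complement
of `X` is `c`. -/
def glue (X : Finset ι) (a : ∀ i : {i // i ∈ X}, κ i) (c : ∀ i : {i // i ∉ X}, κ i) :
    ∀ i, κ i :=
  fun i => if h : i ∈ X then a ⟨i, h⟩ else c ⟨i, h⟩

/-- The partial trace over the complement of `X`, which maps the operators on the whole system
to the operators on the subsystem of the shares in `X`. -/
def partialTrace (X : Finset ι) :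
    Matrix (∀ i, κ i) (∀ i, κ i) ℂ →ₗ[ℂ]
      Matrix (∀ i : {i // i ∈ X}, κ i) (∀ i : {i // i ∈ X}, κ i) ℂ where
  toFun A := Matrix.of fun a b => ∑ c : (∀ i : {i // i ∉ X}, κ i), A (glue X a c) (glue X b c)
  map_add' A B := by
    ext a b
    simp [Finset.sum_add_distrib]
  map_smul' r A := by
    ext a b
    simp [Finset.mul_sum]

/-- A quantum secret sharing scheme that encodes `ℂ^d` into shares `ℂ^(κ i)`, `i : ι`: a quantum
operation into the composite system of all shares which is reversible on all states. -/
structure QSSScheme (d : Type*) [Fintype d] [DecidableEq d] {ι : Type*} [Fintype ι]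
    [DecidableEq ι] (κ : ι → Type*) [∀ i, Fintype (κ i)] [∀ i, DecidableEq (κ i)] where
  /-- the encoding operation -/
  encoder : QuantumOperation d (∀ i, κ i)
  reversible : IsReversible encoder.toLinearMap (densityOperators d)

namespace QSSScheme

variable {d : Type*} [Fintype d] [DecidableEq d] (W : QSSScheme d κ)

/-- The encoder followed by the partial trace over the shares outside `X`. -/
def reduced (X : Finset ι) :
    Matrix d d ℂ →ₗ[ℂ] Matrix (∀ i : {i // i ∈ X}, κ i) (∀ i : {i // i ∈ X}, κ i) ℂ :=
  partialTrace X ∘ₗ W.encoder.toLinearMap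

/-- `X` is qualified: its shares determine the encoded state. -/
def IsQualified (X : Finset ι) : Prop := IsReversible (W.reduced X) (densityOperators d)

/-- `X` is forbidden: its shares carry no information on the encoded state. -/
def IsForbidden (X : Finset ι) : Prop := IsVanishing (W.reduced X) (densityOperators d)

/-- `W` is a pure state scheme: its encoder is a pure state channel. -/
def IsPureStateScheme : Prop := IsPureStateChannel W.encoder.toLinearMap

/-- `W` is a `(k, L, n)`-threshold ramp scheme, where `n` is the number of shares. The difference
`k - L` is one of integers. -/
def IsThresholdRamp (k L : ℕ) : Prop :=
  (∀ X : Finset ι, W.IsForbidden X ↔ (X.card : ℤ) ≤ (k : ℤ) - (L : ℤ)) ∧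
    (∀ X : Finset ι, W.IsQualified X ↔ k ≤ X.card)

end QSSScheme

end Shares

end RampQSS

/-!
By Choi's theorem a quantum operation has Kraus operators, `A ↦ ∑ j, T j * A * (T j)ᴴ`, and it is
reversible on all states exactly when these satisfy the Knill–Laflamme condition: every
`(T i)ᴴ * T j` is a scalar. For the encoder followed by the partial trace onto `X`, the Kraus
operators are the row blocks `T (c, j)` of the encoder's Kraus operators `K j`, where `c` is a basis
index outside `X`. In terms of the same blocks, the shares outside `X` carry no information exactly
when every `∑ j, (T (c, j))ᴴ * T (c', j)` is a scalar. Summing the former condition over `j` gives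
the latter, so the complement of a qualified set is forbidden. A pure state scheme is given by a
single isometry, for which the two conditions coincide. The bounds on the number of shares follow
by comparing the cardinality of a set with that of its complement.
-/

namespace RampQSS

open scoped Kronecker Matrix

section Kraus

variable {n d e s r : Type*}

theorem comp_star_mul_self [Fintype n] [Fintype d] (N : CStarMatrix n n (Matrix d d ℂ)) :
    Matrix.comp n n d d ℂ (CStarMatrix.ofMatrix.symm (star N * N)) =
      (Matrix.comp n n d d ℂ (CStarMatrix.ofMatrix.symm N))ᴴ *
        Matrix.comp n n d d ℂ (CStarMatrix.ofMatrix.symm N) := by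
  ext p q
  simp only [Matrix.comp_apply, CStarMatrix.ofMatrix_symm_apply, CStarMatrix.mul_apply,
    CStarMatrix.star_apply, Matrix.sum_apply, Matrix.mul_apply, Matrix.star_apply,
    Matrix.conjTranspose_apply, Fintype.sum_prod_type]

theorem nonneg_iff_posSemidef_comp [Fintype n] [Fintype d] [DecidableEq d]
    {M : CStarMatrix n n (Matrix d d ℂ)} :
    0 ≤ M ↔ (Matrix.comp n n d d ℂ (CStarMatrix.ofMatrix.symm M)).PosSemidef := by
  classical
  constructor
  · intro hM
    rw [StarOrderedRing.nonneg_iff] at hM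
    induction hM using AddSubmonoid.closure_induction with
    | mem _ h =>
      obtain ⟨N, rfl⟩ := h
      exact comp_star_mul_self N ▸ Matrix.posSemidef_conjTranspose_mul_self _
    | zero => exact Matrix.PosSemidef.zero
    | add _ _ _ _ h₁ h₂ => exact h₁.add h₂
  · intro hM
    obtain ⟨B, hB⟩ := CStarAlgebra.nonneg_iff_eq_star_mul_self.mp
      (Matrix.nonneg_iff_posSemidef.mpr hM)
    let N : CStarMatrix n n (Matrix d d ℂ) :=
      CStarMatrix.ofMatrix ((Matrix.comp n n d d ℂ).symm B)
    have hN : M = star N * N :=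
      (Matrix.comp n n d d ℂ).injective (hB.trans (comp_star_mul_self N).symm)
    exact hN ▸ star_mul_self_nonneg N

/-- The linear map `A ↦ ∑ j, K j * A * (K j)ᴴ` with Kraus operators `K`. -/
def krausMap [Fintype d] [Fintype s] (K : s → Matrix e d ℂ) :
    Matrix d d ℂ →ₗ[ℂ] Matrix e e ℂ where
  toFun A := ∑ j, K j * A * (K j)ᴴ
  map_add' A B := by simp [Matrix.mul_add, Matrix.add_mul, Finset.sum_add_distrib]
  map_smul' r A := by simp [Finset.smul_sum]

theorem krausMap_apply [Fintype d] [Fintype s] (K : s → Matrix e d ℂ) (A : Matrix d d ℂ) :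
    krausMap K A = ∑ j, K j * A * (K j)ᴴ := rfl

theorem krausMap_single_apply [Fintype d] [DecidableEq d] [Fintype s] (K : s → Matrix e d ℂ)
    (a b : d) (i k : e) :
    krausMap K (Matrix.single a b 1) i k = ∑ j, K j i a * star (K j k b) := by
  simp [krausMap_apply, Matrix.sum_apply, Matrix.mul_apply, Matrix.single_apply, ite_and]

theorem krausMap_krausMap [Fintype d] [Fintype e] [Fintype r] [Fintype s]
    (K : r → Matrix n e ℂ) (T : s → Matrix e d ℂ) (A : Matrix d d ℂ) :
    krausMap K (krausMap T A) = krausMap (fun p : r × s => K p.1 * T p.2) A := by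
  simp only [krausMap_apply, Fintype.sum_prod_type, Matrix.mul_sum, Matrix.sum_mul,
    Matrix.conjTranspose_mul, Matrix.mul_assoc]

theorem trace_krausMap [Fintype d] [Fintype e] [Fintype s] (K : s → Matrix e d ℂ)
    (A : Matrix d d ℂ) : (krausMap K A).trace = ((∑ j, (K j)ᴴ * K j) * A).trace := by
  simp only [krausMap_apply, Matrix.trace_sum, Finset.sum_mul]
  refine Finset.sum_congr rfl fun j _ => ?_
  rw [Matrix.trace_mul_comm, Matrix.mul_assoc]

theorem posSemidef_krausMap [Fintype d] [Finite e] [Fintype s] (K : s → Matrix e d ℂ)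
    {A : Matrix d d ℂ} (hA : A.PosSemidef) : (krausMap K A).PosSemidef :=
  Matrix.posSemidef_sum _ fun j _ => hA.mul_mul_conjTranspose_same (K j)

theorem krausMap_mem_densityOperators [Fintype d] [DecidableEq d] [Fintype e] [Fintype s]
    {K : s → Matrix e d ℂ} (hK : ∑ j, (K j)ᴴ * K j = 1) {ρ : Matrix d d ℂ}
    (hρ : ρ ∈ densityOperators d) : krausMap K ρ ∈ densityOperators e :=
  ⟨posSemidef_krausMap K hρ.1, by rw [trace_krausMap, hK, Matrix.one_mul, hρ.2]⟩

theorem linearMap_ext_densityOperators [Fintype d] {M : Type*} [AddCommGroup M] [Module ℂ M]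
    {f g : Matrix d d ℂ →ₗ[ℂ] M} (h : ∀ ρ ∈ densityOperators d, f ρ = g ρ) : f = g := by
  classical
  refine LinearMap.ext_on (CStarAlgebra.span_nonneg (A := Matrix d d ℂ)) fun A hA => ?_
  have hA : A.PosSemidef := Matrix.nonneg_iff_posSemidef.1 hA
  by_cases ht : A.trace = 0
  · simp [hA.trace_eq_zero_iff.1 ht]
  · have hρ : A.trace⁻¹ • A ∈ densityOperators d :=
      ⟨hA.smul (inv_nonneg.2 hA.trace_nonneg), by simp [ht]⟩
    refine smul_right_injective M (inv_ne_zero ht) ?_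
    simpa only [map_smul] using h _ hρ

theorem single_mem_densityOperators [Fintype d] [DecidableEq d] (a : d) :
    Matrix.single a a (1 : ℂ) ∈ densityOperators d :=
  ⟨by simpa using Matrix.posSemidef_conjTranspose_mul_self (Matrix.single a a (1 : ℂ)), by simp⟩

theorem isVanishing_krausMap_iff [Fintype d] [DecidableEq d] [Nonempty d] [Fintype e]
    [Fintype s] {K : s → Matrix e d ℂ} (hK : ∑ j, (K j)ᴴ * K j = 1) :
    IsVanishing (krausMap K) (densityOperators d) ↔
      ∃ ρ₀ : Matrix e e ℂ, ∀ A, krausMap K A = A.trace • ρ₀ := by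
  constructor
  · rintro ⟨ρ₀, -, hρ₀⟩
    refine ⟨ρ₀, LinearMap.congr_fun (linearMap_ext_densityOperators
      (g := (Matrix.traceLinearMap d ℂ ℂ).smulRight ρ₀) fun ρ hρ => ?_)⟩
    simp [hρ₀ ρ hρ, hρ.2]
  · rintro ⟨ρ₀, hρ₀⟩
    have map_density {ρ : Matrix d d ℂ} (hρ : ρ ∈ densityOperators d) : krausMap K ρ = ρ₀ := by
      rw [hρ₀, hρ.2, one_smul]
    have hd := single_mem_densityOperators (Classical.arbitrary d)
    exact ⟨ρ₀, map_density hd ▸ krausMap_mem_densityOperators hK hd, fun ρ => map_density⟩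

theorem comp_map_krausMap [Fintype n] [DecidableEq n] [Fintype d] [Fintype s]
    (K : s → Matrix e d ℂ) (M : Matrix n n (Matrix d d ℂ)) :
    Matrix.comp n n e e ℂ (M.map (krausMap K)) =
      krausMap (fun j => (1 : Matrix n n ℂ) ⊗ₖ K j) (Matrix.comp n n d d ℂ M) := by
  ext p q
  simp [krausMap_apply, Matrix.sum_apply, Matrix.mul_apply, Fintype.sum_prod_type,
    Matrix.one_apply, apply_ite, Finset.sum_ite_irrel]

variable [Fintype d] [DecidableEq d] [Fintype e] [DecidableEq e]

/-- Choi's theorem: the Kraus operators are the rows of a square root of the Choi matrix. -/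
theorem exists_eq_krausMap (f : Matrix d d ℂ →CP Matrix e e ℂ) :
    ∃ K : d × e → Matrix e d ℂ, f.toLinearMap = krausMap K := by
  let ω : CStarMatrix d d (Matrix d d ℂ) :=
    CStarMatrix.ofMatrix fun a b => Matrix.single a b 1
  have hω : 0 ≤ ω := by
    rw [nonneg_iff_posSemidef_comp]
    convert Matrix.posSemidef_vecMulVec_self_star fun p : d × d => if p.1 = p.2 then (1 : ℂ) else 0
    ext ⟨a, i⟩ ⟨b, k⟩
    change Matrix.single a b (1 : ℂ) i k = _
    simp [Matrix.single_apply, Matrix.vecMulVec_apply, ← ite_and, and_comm]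
  obtain ⟨B, hB⟩ := CStarAlgebra.nonneg_iff_eq_star_mul_self.mp
    (Matrix.nonneg_iff_posSemidef.mpr
      (nonneg_iff_posSemidef_comp.mp (f.map_cstarMatrix_nonneg ω hω)))
  refine ⟨fun j => Matrix.of fun i a => star (B j (a, i)), Matrix.ext_linearMap _ fun a b => ?_⟩
  ext i k
  have hentry : f.toLinearMap (Matrix.single a b 1) i k = ∑ j, star (B j (a, i)) * B j (b, k) :=
    congrFun₂ hB (a, i) (b, k)
  simp [hentry, krausMap_single_apply]

theorem map_krausMap_nonneg [Fintype s] [Fintype n] (K : s → Matrix e d ℂ)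
    {M : CStarMatrix n n (Matrix d d ℂ)} (hM : 0 ≤ M) : 0 ≤ M.map (krausMap K) := by
  classical
  rw [nonneg_iff_posSemidef_comp] at hM ⊢
  exact (comp_map_krausMap K (CStarMatrix.ofMatrix.symm M)) ▸ posSemidef_krausMap _ hM

/-- The quantum operation with Kraus operators `K`. -/
def QuantumOperation.ofKraus [Fintype s] (K : s → Matrix e d ℂ) (hK : ∑ j, (K j)ᴴ * K j = 1) :
    QuantumOperation d e where
  toLinearMap := krausMap K
  map_cstarMatrix_nonneg' _ _ hM := map_krausMap_nonneg K hM
  trace_map A := by rw [trace_krausMap, hK, Matrix.one_mul]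

theorem QuantumOperation.exists_eq_krausMap (R : QuantumOperation d e) :
    ∃ K : d × e → Matrix e d ℂ, R.toLinearMap = krausMap K ∧ ∑ j, (K j)ᴴ * K j = 1 := by
  obtain ⟨K, hK⟩ := RampQSS.exists_eq_krausMap R.toCompletelyPositiveMap
  refine ⟨K, hK, Matrix.ext_iff_trace_mul_right.mpr fun A => ?_⟩
  rw [← trace_krausMap, ← hK, R.trace_map, Matrix.one_mul]

theorem isReversible_densityOperators_iff {E : Matrix d d ℂ →ₗ[ℂ] Matrix e e ℂ} :
    IsReversible E (densityOperators d) ↔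
      ∃ R : QuantumOperation e d, ∀ A, R.toLinearMap (E A) = A :=
  exists_congr fun R => ⟨fun h => LinearMap.congr_fun
    (linearMap_ext_densityOperators (f := R.toLinearMap ∘ₗ E) (g := LinearMap.id) h),
    fun h ρ _ => h ρ⟩

end Kraus

section KnillLaflamme

variable {d e s r m : Type*}

theorem exists_eq_smul_one_of_krausMap_eq_id [Fintype d] [DecidableEq d] [Fintype s]
    {K : s → Matrix d d ℂ} (h : ∀ A, krausMap K A = A) (j : s) : ∃ c : ℂ, K j = c • 1 := by
  -- Expanding the squares leaves only values of `krausMap K`, so all commutators vanish.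
  have sum_commutator (A : Matrix d d ℂ) :
      ∑ j, (K j * A - A * K j) * (K j * A - A * K j)ᴴ = 0 := by
    calc ∑ j, (K j * A - A * K j) * (K j * A - A * K j)ᴴ
        = krausMap K (A * Aᴴ) - krausMap K A * Aᴴ - A * krausMap K Aᴴ
            + A * krausMap K 1 * Aᴴ := by
          simp only [krausMap_apply, Matrix.mul_sum, Matrix.sum_mul, ← Finset.sum_sub_distrib,
            ← Finset.sum_add_distrib, Matrix.conjTranspose_sub, Matrix.conjTranspose_mul]
          exact Finset.sum_congr rfl fun j _ => by noncomm_ring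
      _ = 0 := by simp only [h]; noncomm_ring
  have commute (A : Matrix d d ℂ) : K j * A = A * K j := by
    have := (Finset.sum_eq_zero_iff_of_nonneg fun j _ => mul_star_self_nonneg _).1
      (sum_commutator A) j (Finset.mem_univ j)
    exact sub_eq_zero.1 (Matrix.self_mul_conjTranspose_eq_zero.1 this)
  obtain ⟨c, hc⟩ := Matrix.mem_range_scalar_iff_commute_single'.2 fun a b => (commute _).symm
  exact ⟨c, by rw [← hc, Matrix.smul_one_eq_diagonal]; rfl⟩

/-- The Knill–Laflamme condition with matrix `σ`: the operators `T` map the space `ℂ^d`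
conformally, and with mutual Gram matrix `σ`, into `ℂ^e`. -/
def KnillLaflamme [Fintype e] [DecidableEq d] (T : s → Matrix e d ℂ) (σ : Matrix s s ℂ) : Prop :=
  ∀ i j, (T i)ᴴ * T j = σ i j • 1

/-- The operators `∑ q, N q j • W q`, the form which a change of Kraus operators takes. -/
def combine [Fintype r] (W : r → Matrix e d ℂ) (N : Matrix r s ℂ) : s → Matrix e d ℂ :=
  fun j => ∑ q, N q j • W q

theorem combine_combine [Fintype r] [Fintype s] (W : r → Matrix e d ℂ) (M : Matrix r s ℂ)
    (N : Matrix s m ℂ) : combine (combine W M) N = combine W (M * N) := by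
  ext j : 1
  simp only [combine, Finset.smul_sum, smul_smul, Matrix.mul_apply, Finset.sum_smul]
  rw [Finset.sum_comm]
  simp only [mul_comm]

theorem combine_one [Fintype r] [DecidableEq r] (W : r → Matrix e d ℂ) : combine W 1 = W := by
  ext j : 1
  simp [combine, Matrix.one_apply]

theorem combine_sub [Fintype r] (W : r → Matrix e d ℂ) (M N : Matrix r s ℂ) :
    combine W (M - N) = combine W M - combine W N := by
  ext j : 1
  simp [combine, sub_smul]

theorem krausMap_combine [Fintype d] [Fintype r] [Fintype s] (W : r → Matrix e d ℂ)
    (N : Matrix r s ℂ) (A : Matrix d d ℂ) :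
    krausMap (combine W N) A = ∑ q, ∑ q', (N * Nᴴ) q q' • (W q * A * (W q')ᴴ) := by
  simp only [krausMap_apply, combine, Matrix.conjTranspose_sum, Matrix.conjTranspose_smul,
    Matrix.sum_mul, Matrix.mul_sum, Matrix.smul_mul, Matrix.mul_smul, Finset.smul_sum,
    smul_smul, Matrix.mul_apply, Matrix.conjTranspose_apply, Finset.sum_smul]
  calc _ = ∑ q', ∑ q, ∑ j, (star (N q' j) * N q j) • (W q * A * (W q')ᴴ) := by
        rw [Finset.sum_comm]
        exact Finset.sum_congr rfl fun q' _ => Finset.sum_comm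
    _ = _ := by
        rw [Finset.sum_comm]
        simp only [mul_comm]

theorem exists_conjTranspose_mul_self_eq_of_posSemidef [Fintype s] {σ : Matrix s s ℂ}
    (hσ : σ.PosSemidef) :
    ∃ (N : Matrix (Fin σ.rank) s ℂ) (M : Matrix s (Fin σ.rank) ℂ), Nᴴ * N = σ ∧ N * M = 1 := by
  classical
  let p : s → ℝ := hσ.1.eigenvalues
  let U : Matrix s s ℂ := hσ.1.eigenvectorUnitary
  have hU : Uᴴ * U = 1 := Unitary.coe_star_mul_self hσ.1.eigenvectorUnitary
  have hspec : σ = U * Matrix.diagonal (fun i => (p i : ℂ)) * Uᴴ := hσ.1.spectral_theorem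
  have hp (i : s) : (√(p i) : ℂ) * √(p i) = p i := by
    rw [← Complex.ofReal_mul, Real.mul_self_sqrt (hσ.eigenvalues_nonneg i)]
  let f : Fin σ.rank ≃ {i // p i ≠ 0} :=
    (Fintype.equivFinOfCardEq hσ.1.rank_eq_card_non_zero_eigs.symm).symm
  refine ⟨Matrix.of fun q j => √(p (f q)) * star (U j (f q)),
    Matrix.of fun j q => U j (f q) / √(p (f q)), ?_, ?_⟩
  · ext i j
    calc _ = ∑ q, U i (f q) * p (f q) * star (U j (f q)) := by
          simp only [Matrix.mul_apply, Matrix.conjTranspose_apply, Matrix.of_apply, ← hp, star_mul',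
            RCLike.star_def, Complex.conj_ofReal, Complex.conj_conj]
          exact Finset.sum_congr rfl fun q _ => by ring
      _ = ∑ k : {k // p k ≠ 0}, U i k * p k * star (U j k) :=
          f.sum_comp fun k => U i k * p k * star (U j k)
      _ = ∑ k, U i k * p k * star (U j k) := by
          rw [← Fintype.sum_subtype_add_sum_subtype (fun k => p k ≠ 0), left_eq_add]
          exact Finset.sum_eq_zero fun k _ => by simp [not_not.1 k.2]
      _ = σ i j := by
          simp [hspec, Matrix.mul_apply, Matrix.diagonal_apply]
  · ext q q'
    have hq : (√(p (f q')) : ℂ) ≠ 0 :=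
      Complex.ofReal_ne_zero.2 (Real.sqrt_ne_zero'.2 ((hσ.eigenvalues_nonneg _).lt_of_ne' (f q').2))
    calc _ = √(p (f q)) / √(p (f q')) * (Uᴴ * U) (f q) (f q') := by
          simp only [Matrix.mul_apply, Matrix.conjTranspose_apply, Matrix.of_apply, Finset.mul_sum]
          exact Finset.sum_congr rfl fun q _ => by ring
      _ = (1 : Matrix _ _ ℂ) q q' := by
          obtain rfl | h := eq_or_ne q q' <;> simp [*, f.injective.eq_iff, Subtype.val_inj]

namespace KnillLaflamme

variable [DecidableEq d] [Fintype e] {T : s → Matrix e d ℂ} {σ : Matrix s s ℂ}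

theorem combine [Fintype s] (h : KnillLaflamme T σ) (M : Matrix s r ℂ) :
    KnillLaflamme (combine T M) (Mᴴ * σ * M) := by
  intro i j
  simp only [RampQSS.combine, Matrix.conjTranspose_sum, Matrix.conjTranspose_smul, Matrix.sum_mul,
    Matrix.mul_sum, Matrix.smul_mul, Matrix.mul_smul, h _ _, Finset.smul_sum, smul_smul,
    Matrix.mul_apply, Matrix.conjTranspose_apply, Finset.sum_smul, Finset.sum_mul]
  simp only [mul_comm, mul_left_comm]

theorem eq_zero (h : KnillLaflamme T 0) : T = 0 :=
  funext fun j => Matrix.conjTranspose_mul_self_eq_zero.1 (by simpa using h j j)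

theorem exists_of_krausMap_krausMap [Fintype d] [DecidableEq e] [Fintype r] [Fintype s]
    {K : r → Matrix d e ℂ} (hK : ∑ j, (K j)ᴴ * K j = 1) (h : ∀ A, krausMap K (krausMap T A) = A) :
    ∃ σ, KnillLaflamme T σ := by
  simp only [krausMap_krausMap] at h
  choose c hc using exists_eq_smul_one_of_krausMap_eq_id h
  refine ⟨Matrix.of fun i j => ∑ l, star (c (l, i)) * c (l, j), fun i j => ?_⟩
  calc (T i)ᴴ * T j = (T i)ᴴ * (∑ l, (K l)ᴴ * K l) * T j := by rw [hK, Matrix.mul_one]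
    _ = ∑ l, (K l * T i)ᴴ * (K l * T j) := by
      simp only [Matrix.mul_sum, Matrix.sum_mul, Matrix.conjTranspose_mul, Matrix.mul_assoc]
    _ = ∑ l, (star (c (l, i)) * c (l, j)) • 1 := by
      refine Finset.sum_congr rfl fun l _ => ?_
      rw [hc (l, i), hc (l, j)]
      simp [smul_smul, mul_comm]
    _ = _ := by rw [← Finset.sum_smul, Matrix.of_apply]

theorem of_mul_column (h : KnillLaflamme T σ) (a : d) :
    (Matrix.of fun i j => T j i a)ᴴ * (Matrix.of fun i j => T j i a) = σ := by
  ext i j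
  simpa [Matrix.mul_apply] using congrFun₂ (h i j) a a

theorem posSemidef [Nonempty d] [Finite s] (h : KnillLaflamme T σ) : σ.PosSemidef :=
  h.of_mul_column (Classical.arbitrary d) ▸ Matrix.posSemidef_conjTranspose_mul_self _

theorem rank_krausMap_single [Fintype d] [Fintype s] (h : KnillLaflamme T σ) (a : d) :
    (krausMap T (Matrix.single a a 1)).rank = σ.rank := by
  have hcol : krausMap T (Matrix.single a a 1) =
      (Matrix.of fun i j => T j i a) * (Matrix.of fun i j => T j i a)ᴴ := by
    ext i k
    simp [krausMap_single_apply, Matrix.mul_apply]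
  rw [hcol, Matrix.rank_self_mul_conjTranspose, ← Matrix.rank_conjTranspose_mul_self,
    h.of_mul_column]

theorem trace_eq_one [Nonempty d] [Fintype s] (h : KnillLaflamme T σ)
    (hT : ∑ j, (T j)ᴴ * T j = 1) : σ.trace = 1 := by
  have hσ : σ.trace • (1 : Matrix d d ℂ) = 1 := by
    refine Eq.trans ?_ hT
    simp only [h _ _, Matrix.trace, Finset.sum_smul, Matrix.diag_apply]
  simpa using congrFun₂ hσ (Classical.arbitrary d) (Classical.arbitrary d)

theorem exists_combine [Nonempty d] [Fintype s] (h : KnillLaflamme T σ) :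
    ∃ (W : Fin σ.rank → Matrix e d ℂ) (N : Matrix (Fin σ.rank) s ℂ),
      KnillLaflamme W 1 ∧ Nᴴ * N = σ ∧ RampQSS.combine W N = T := by
  classical
  obtain ⟨N, M, hσ, hNM⟩ := exists_conjTranspose_mul_self_eq_of_posSemidef h.posSemidef
  refine ⟨RampQSS.combine T M, N, ?_, hσ, ?_⟩
  · have hW : Mᴴ * σ * M = (N * M)ᴴ * (N * M) := by
      simp only [← hσ, Matrix.conjTranspose_mul, Matrix.mul_assoc]
    simpa [hW, hNM] using h.combine M
  · have hker : (M * N - 1)ᴴ * σ * (M * N - 1) = 0 := by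
      have hN : N * (M * N - 1) = 0 := by
        rw [Matrix.mul_sub, ← Matrix.mul_assoc, hNM, Matrix.one_mul, Matrix.mul_one, sub_self]
      calc (M * N - 1)ᴴ * σ * (M * N - 1) = (M * N - 1)ᴴ * (Nᴴ * N) * (M * N - 1) := by rw [hσ]
        _ = 0 := by rw [Matrix.mul_assoc, Matrix.mul_assoc, hN, Matrix.mul_zero, Matrix.mul_zero]
    have := (hker ▸ h.combine (M * N - 1)).eq_zero
    rwa [combine_sub, combine_one, ← combine_combine, sub_eq_zero] at this

end KnillLaflamme

theorem sum_single_mul_conjTranspose_mul_single_mul [Fintype d] [DecidableEq d] [Fintype e]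
    [DecidableEq e] (a : d) {Q : Matrix e e ℂ} (hQ : IsStarProjection Q) :
    ∑ x : e, (Matrix.single a x (1 : ℂ) * Q)ᴴ * (Matrix.single a x (1 : ℂ) * Q) = Q :=
  calc ∑ x : e, (Matrix.single a x (1 : ℂ) * Q)ᴴ * (Matrix.single a x (1 : ℂ) * Q)
      = Qᴴ * (∑ x : e, Matrix.single x x (1 : ℂ)) * Q := by
        simp only [Matrix.mul_sum, Matrix.sum_mul, Matrix.conjTranspose_mul, Matrix.mul_assoc,
          Matrix.conjTranspose_single, star_one, ← Matrix.mul_assoc (Matrix.single _ a _),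
          Matrix.single_mul_single_same, mul_one]
    _ = Q := by
        rw [Matrix.sum_single_one, Matrix.mul_one, ← Matrix.star_eq_conjTranspose,
          hQ.isSelfAdjoint.star_eq, hQ.isIdempotentElem.eq]

theorem QuantumOperation.exists_eq_krausMap_of_isStarProjection [Fintype d] [DecidableEq d]
    [Nonempty d] [Fintype e] [DecidableEq e] [Fintype s] {K : s → Matrix d e ℂ}
    (hK : IsStarProjection (∑ j, (K j)ᴴ * K j)) :
    ∃ R : QuantumOperation e d,
      ∀ B, (∑ j, (K j)ᴴ * K j) * B = B → R.toLinearMap B = krausMap K B := by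
  let Q := 1 - ∑ j, (K j)ᴴ * K j
  -- The additional operators send the range of `Q` to one fixed basis state.
  let F : s ⊕ e → Matrix d e ℂ :=
    Sum.elim K fun x => Matrix.single (Classical.arbitrary d) x (1 : ℂ) * Q
  have hF : ∑ j, (F j)ᴴ * F j = 1 := by
    simp only [Fintype.sum_sum_type, F, Sum.elim_inl, Sum.elim_inr,
      sum_single_mul_conjTranspose_mul_single_mul _ hK.one_sub, Q]
    exact add_sub_cancel _ _
  refine ⟨.ofKraus F hF, fun B hB => ?_⟩
  have hQB : Q * B = 0 := by rw [Matrix.sub_mul, Matrix.one_mul, hB, sub_self]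
  change krausMap F B = _
  simp only [krausMap_apply, Fintype.sum_sum_type, F, Sum.elim_inl, Sum.elim_inr,
    Matrix.mul_assoc _ Q B, hQB, Matrix.mul_zero, Matrix.zero_mul, Finset.sum_const_zero, add_zero]

namespace KnillLaflamme

variable [Fintype d] [DecidableEq d] [Nonempty d] [Fintype e] [DecidableEq e] [Fintype s]
  {T : s → Matrix e d ℂ} {σ : Matrix s s ℂ}

theorem exists_mul_mul_eq_smul [Finite r] [DecidableEq r] {W : r → Matrix e d ℂ}
    (h : KnillLaflamme W 1) :
    ∃ R : QuantumOperation e d,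
      ∀ q q' A, R.toLinearMap (W q * A * (W q')ᴴ) = (1 : Matrix r r ℂ) q q' • A := by
  have := Fintype.ofFinite r
  let P := ∑ q, ((W q)ᴴ)ᴴ * (W q)ᴴ
  have mul_range (q : r) : P * W q = W q := by
    simp only [P, Matrix.sum_mul, Matrix.mul_assoc, h _ _, Matrix.conjTranspose_conjTranspose,
      Matrix.mul_smul, Matrix.mul_one]
    simp [Matrix.one_apply]
  have hP : IsStarProjection P := by
    refine ⟨?_, isSelfAdjoint_sum _ fun q _ => Matrix.isHermitian_conjTranspose_mul_self _⟩
    change P * ∑ q, _ = ∑ q, _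
    simp only [Matrix.mul_sum, ← Matrix.mul_assoc, Matrix.conjTranspose_conjTranspose, mul_range]
  obtain ⟨R, hR⟩ := QuantumOperation.exists_eq_krausMap_of_isStarProjection hP
  refine ⟨R, fun q q' A => ?_⟩
  have conj_mul (p : r) :
      (W p)ᴴ * (W q * A * (W q')ᴴ) * W p =
        (1 : Matrix r r ℂ) q' p • (1 : Matrix r r ℂ) p q • A := by
    simp only [Matrix.mul_assoc, h _ _]
    simp only [← Matrix.mul_assoc, h _ _]
    simp
  rw [hR _ (by rw [← Matrix.mul_assoc, ← Matrix.mul_assoc, mul_range]), krausMap_apply]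
  simp [conj_mul, Matrix.one_apply, eq_comm]

theorem exists_krausMap_eq_self (h : KnillLaflamme T σ) (hT : ∑ j, (T j)ᴴ * T j = 1) :
    ∃ R : QuantumOperation e d, ∀ A, R.toLinearMap (krausMap T A) = A := by
  obtain ⟨W, N, hW, hσ, hWN⟩ := h.exists_combine
  obtain ⟨R, hR⟩ := hW.exists_mul_mul_eq_smul
  have htrace : (N * Nᴴ).trace = 1 := by rw [Matrix.trace_mul_comm, hσ, h.trace_eq_one hT]
  refine ⟨R, fun A => ?_⟩
  calc R.toLinearMap (krausMap T A)
      = ∑ q, ∑ q', (N * Nᴴ) q q' • (1 : Matrix _ _ ℂ) q q' • A := by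
        simp only [← hWN, krausMap_combine, map_sum, map_smul, hR]
    _ = (N * Nᴴ).trace • A := by
        simp [Matrix.one_apply, Matrix.trace, Finset.sum_smul]
    _ = A := by rw [htrace, one_smul]

end KnillLaflamme

theorem isReversible_krausMap_iff [Fintype d] [DecidableEq d] [Nonempty d] [Fintype e]
    [DecidableEq e] [Fintype s] {T : s → Matrix e d ℂ} (hT : ∑ j, (T j)ᴴ * T j = 1) :
    IsReversible (krausMap T) (densityOperators d) ↔ ∃ σ, KnillLaflamme T σ := by
  rw [isReversible_densityOperators_iff]
  constructor
  · rintro ⟨R, hR⟩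
    obtain ⟨K, hRK, hK⟩ := R.exists_eq_krausMap
    exact KnillLaflamme.exists_of_krausMap_krausMap hK fun A => hRK ▸ hR A
  · rintro ⟨σ, h⟩
    exact h.exists_krausMap_eq_self hT

theorem rank_le_one_of_mem_pureStates [Fintype d] {ρ : Matrix d d ℂ} (hρ : ρ ∈ pureStates d) :
    ρ.rank ≤ 1 := by
  obtain ⟨ψ, -, rfl⟩ := hρ
  exact Matrix.rank_vecMulVec_le _ _

theorem single_mem_pureStates [Fintype d] [DecidableEq d] (a : d) :
    Matrix.single a a (1 : ℂ) ∈ pureStates d := by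
  refine ⟨EuclideanSpace.single a 1, by simp, ?_⟩
  ext i j
  simp [Matrix.single_apply, ← ite_and, and_comm, eq_comm]

theorem IsPureStateChannel.exists_isometry [Fintype d] [DecidableEq d] [Nonempty d] [Fintype e]
    [DecidableEq e] [Fintype s] {T : s → Matrix e d ℂ} (hT : ∑ j, (T j)ᴴ * T j = 1)
    (hpure : IsPureStateChannel (krausMap T))
    (hrev : IsReversible (krausMap T) (densityOperators d)) :
    ∃ V : Matrix e d ℂ, Vᴴ * V = 1 ∧ krausMap T = krausMap fun _ : Unit => V := by
  obtain ⟨σ, h⟩ := (isReversible_krausMap_iff hT).1 hrev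
  obtain ⟨W, N, hW, hσ, hWN⟩ := h.exists_combine
  have hle : σ.rank ≤ 1 := by
    rw [← h.rank_krausMap_single (Classical.arbitrary d)]
    exact rank_le_one_of_mem_pureStates (hpure _ (single_mem_pureStates _))
  have htrace : (N * Nᴴ).trace = 1 := by rw [Matrix.trace_mul_comm, hσ, h.trace_eq_one hT]
  have : Subsingleton (Fin σ.rank) := Fin.subsingleton_iff_le_one.2 hle
  have : Nonempty (Fin σ.rank) := by
    by_contra hempty
    rw [not_nonempty_iff] at hempty
    simp [Matrix.trace] at htrace
  obtain ⟨_⟩ := nonempty_unique (Fin σ.rank)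
  have hN : (N * Nᴴ) default default = 1 := by simpa [Matrix.trace] using htrace
  refine ⟨W default, by simpa using hW default default, LinearMap.ext fun A => ?_⟩
  rw [← hWN, krausMap_combine]
  simp [hN, krausMap_apply]

end KnillLaflamme

section Shares

variable {ι : Type*} [Fintype ι] [DecidableEq ι] {κ : ι → Type*} {d s : Type*}

/-- The identification of the two descriptions of a basis index outside `X`. -/
def complEquiv (X : Finset ι) : (∀ i : {i // i ∉ X}, κ i) ≃ (∀ i : {i // i ∈ Xᶜ}, κ i) where
  toFun c i := c ⟨i, Finset.mem_compl.1 i.2⟩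
  invFun c i := c ⟨i, Finset.mem_compl.2 i.2⟩

/-- The identification of the two descriptions of a basis index inside `X`. -/
def complComplEquiv (X : Finset ι) : (∀ i : {i // i ∈ X}, κ i) ≃ (∀ i : {i // i ∉ Xᶜ}, κ i) where
  toFun a i := a ⟨i, Finset.notMem_compl.1 i.2⟩
  invFun a i := a ⟨i, Finset.notMem_compl.2 i.2⟩

theorem glue_compl (X : Finset ι) (a : ∀ i : {i // i ∈ X}, κ i) (c : ∀ i : {i // i ∉ X}, κ i) :
    glue Xᶜ (complEquiv X c) (complComplEquiv X a) = glue X a c := by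
  funext i
  by_cases h : i ∈ X <;> simp [glue, complEquiv, complComplEquiv, h]

variable [∀ i, Fintype (κ i)]

theorem sum_glue {M : Type*} [AddCommMonoid M] (X : Finset ι) (f : (∀ i, κ i) → M) :
    ∑ c, ∑ a, f (glue X a c) = ∑ x, f x := by
  rw [Finset.sum_comm, ← Fintype.sum_prod_type']
  exact (Equiv.piEquivPiSubtypeProd (· ∈ X) κ).symm.sum_comp f

/-- The Kraus operators of `partialTrace X ∘ₗ krausMap K`: the rows of the operators `K j` whose
index has a given part `c` outside `X`. -/
def block (X : Finset ι) (K : s → Matrix (∀ i, κ i) d ℂ) (p : (∀ i : {i // i ∉ X}, κ i) × s) :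
    Matrix (∀ i : {i // i ∈ X}, κ i) d ℂ :=
  (K p.2).submatrix (glue X · p.1) id

theorem partialTrace_comp_krausMap [Fintype d] [Fintype s] (X : Finset ι)
    (K : s → Matrix (∀ i, κ i) d ℂ) :
    partialTrace X ∘ₗ krausMap K = krausMap (block X K) := by
  ext A a b
  simp [partialTrace, krausMap_apply, Matrix.sum_apply, Fintype.sum_prod_type, block,
    Matrix.mul_apply]

theorem sum_conjTranspose_block_mul_block (X : Finset ι) (K : s → Matrix (∀ i, κ i) d ℂ)
    (j j' : s) : ∑ c, (block X K (c, j))ᴴ * block X K (c, j') = (K j)ᴴ * K j' := by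
  ext a b
  simp only [Matrix.sum_apply, Matrix.mul_apply]
  exact sum_glue X fun x => star (K j x a) * K j' x b

theorem sum_conjTranspose_block_mul_self [DecidableEq d] [Fintype s] (X : Finset ι)
    {K : s → Matrix (∀ i, κ i) d ℂ} (hK : ∑ j, (K j)ᴴ * K j = 1) :
    ∑ p, (block X K p)ᴴ * block X K p = 1 := by
  rw [Fintype.sum_prod_type_right]
  simp only [sum_conjTranspose_block_mul_block, hK]

theorem partialTrace_compl_krausMap_apply [Fintype d] [Fintype s] (X : Finset ι)
    (K : s → Matrix (∀ i, κ i) d ℂ) (A : Matrix d d ℂ) (c c' : ∀ i : {i // i ∉ X}, κ i) :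
    partialTrace Xᶜ (krausMap K A) (complEquiv X c) (complEquiv X c') =
      ((∑ j, (block X K (c', j))ᴴ * block X K (c, j)) * A).trace := by
  calc _ = ∑ a, krausMap K A (glue X a c) (glue X a c') := by
        simp_rw [fun c a => (glue_compl X a c).symm]
        exact ((complComplEquiv X).sum_comp _).symm
    _ = ∑ j, (block X K (c, j) * A * (block X K (c', j))ᴴ).trace := by
        simp only [krausMap_apply, Matrix.sum_apply]
        exact Finset.sum_comm
    _ = _ := by
        rw [Finset.sum_mul, Matrix.trace_sum]
        exact Finset.sum_congr rfl fun j _ => by rw [Matrix.trace_mul_comm, Matrix.mul_assoc]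

theorem isVanishing_partialTrace_compl_iff [Fintype d] [DecidableEq d] [Nonempty d] [Fintype s]
    {K : s → Matrix (∀ i, κ i) d ℂ} (hK : ∑ j, (K j)ᴴ * K j = 1) (X : Finset ι) :
    IsVanishing (partialTrace Xᶜ ∘ₗ krausMap K) (densityOperators d) ↔
      ∃ τ : Matrix (∀ i : {i // i ∉ X}, κ i) (∀ i : {i // i ∉ X}, κ i) ℂ,
        ∀ c c', ∑ j, (block X K (c, j))ᴴ * block X K (c', j) = τ c c' • 1 := by
  rw [partialTrace_comp_krausMap,
    isVanishing_krausMap_iff (sum_conjTranspose_block_mul_self Xᶜ hK)]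
  simp only [← partialTrace_comp_krausMap, LinearMap.comp_apply]
  constructor
  · rintro ⟨ρ₀, hρ₀⟩
    refine ⟨(ρ₀.submatrix (complEquiv X) (complEquiv X))ᵀ, fun c c' => ?_⟩
    refine Matrix.ext_iff_trace_mul_right.2 fun A => ?_
    rw [← partialTrace_compl_krausMap_apply, hρ₀]
    simp [mul_comm]
  · rintro ⟨τ, hτ⟩
    refine ⟨τᵀ.submatrix (complEquiv X).symm (complEquiv X).symm, fun A => ?_⟩
    rw [← (Matrix.reindex (complEquiv X).symm (complEquiv X).symm).injective.eq_iff]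
    ext c c'
    have := partialTrace_compl_krausMap_apply X K A c c'
    rw [hτ] at this
    simpa [mul_comm] using this

variable [∀ i, DecidableEq (κ i)] [Fintype d] [DecidableEq d] [Nonempty d] [Fintype s]

theorem isVanishing_partialTrace_compl_of_isReversible {K : s → Matrix (∀ i, κ i) d ℂ}
    (hK : ∑ j, (K j)ᴴ * K j = 1) {X : Finset ι}
    (h : IsReversible (partialTrace X ∘ₗ krausMap K) (densityOperators d)) :
    IsVanishing (partialTrace Xᶜ ∘ₗ krausMap K) (densityOperators d) := by
  rw [partialTrace_comp_krausMap,
    isReversible_krausMap_iff (sum_conjTranspose_block_mul_self X hK)] at h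
  obtain ⟨σ, hσ⟩ := h
  refine (isVanishing_partialTrace_compl_iff hK X).2
    ⟨Matrix.of fun c c' => ∑ j, σ (c, j) (c', j), fun c c' => ?_⟩
  simp only [hσ _ _, Matrix.of_apply, Finset.sum_smul]

theorem isReversible_partialTrace_of_isVanishing_compl {V : Matrix (∀ i, κ i) d ℂ} (hV : Vᴴ * V = 1)
    {X : Finset ι}
    (h : IsVanishing (partialTrace Xᶜ ∘ₗ krausMap fun _ : Unit => V) (densityOperators d)) :
    IsReversible (partialTrace X ∘ₗ krausMap fun _ : Unit => V) (densityOperators d) := by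
  have hK : ∑ _ : Unit, Vᴴ * V = 1 := by simpa using hV
  obtain ⟨τ, hτ⟩ := (isVanishing_partialTrace_compl_iff hK X).1 h
  rw [partialTrace_comp_krausMap,
    isReversible_krausMap_iff (sum_conjTranspose_block_mul_self X hK)]
  exact ⟨τ.submatrix Prod.fst Prod.fst, fun p q => by simpa using hτ p.1 q.1⟩

theorem isReversible_partialTrace_univ {K : s → Matrix (∀ i, κ i) d ℂ}
    (hK : ∑ j, (K j)ᴴ * K j = 1) (h : IsReversible (krausMap K) (densityOperators d)) :
    IsReversible (partialTrace Finset.univ ∘ₗ krausMap K) (densityOperators d) := by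
  obtain ⟨σ, hσ⟩ := (isReversible_krausMap_iff hK).1 h
  rw [partialTrace_comp_krausMap,
    isReversible_krausMap_iff (sum_conjTranspose_block_mul_self _ hK)]
  have : IsEmpty {i // i ∉ (Finset.univ : Finset ι)} := ⟨fun i => i.2 (Finset.mem_univ _)⟩
  refine ⟨σ.submatrix Prod.snd Prod.snd, fun ⟨c, j⟩ ⟨c', j'⟩ => ?_⟩
  obtain rfl := Subsingleton.elim c c'
  calc (block Finset.univ K (c, j))ᴴ * block Finset.univ K (c, j')
      = ∑ c, (block Finset.univ K (c, j))ᴴ * block Finset.univ K (c, j') := by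
        rw [Fintype.sum_subsingleton _ c]
    _ = σ j j' • 1 := by rw [sum_conjTranspose_block_mul_block, hσ]

namespace QSSScheme

variable {W : QSSScheme d κ}

theorem IsQualified.isForbidden_compl {X : Finset ι} (h : W.IsQualified X) :
    W.IsForbidden Xᶜ := by
  obtain ⟨K, hWK, hK⟩ := W.encoder.exists_eq_krausMap
  rw [IsQualified, reduced, hWK] at h
  rw [IsForbidden, reduced, hWK]
  exact isVanishing_partialTrace_compl_of_isReversible hK h

theorem isQualified_univ (W : QSSScheme d κ) : W.IsQualified Finset.univ := by
  obtain ⟨K, hWK, hK⟩ := W.encoder.exists_eq_krausMap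
  rw [IsQualified, reduced, hWK]
  exact isReversible_partialTrace_univ hK (hWK ▸ W.reversible)

theorem IsPureStateScheme.isQualified_of_isForbidden_compl (hpure : W.IsPureStateScheme)
    {X : Finset ι} (h : W.IsForbidden Xᶜ) : W.IsQualified X := by
  obtain ⟨K, hWK, hK⟩ := W.encoder.exists_eq_krausMap
  obtain ⟨V, hV, hKV⟩ := IsPureStateChannel.exists_isometry hK (hWK ▸ hpure) (hWK ▸ W.reversible)
  rw [IsForbidden, reduced, hWK, hKV] at h
  rw [IsQualified, reduced, hWK, hKV]
  exact isReversible_partialTrace_of_isVanishing_compl hV h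

theorem card_le_two_mul_sub {k L : ℕ} (hforbidden : ∀ X, W.IsForbidden X → (X.card : ℤ) ≤ k - L)
    (hqualified : ∀ X : Finset ι, k ≤ X.card → W.IsQualified X) :
    (Fintype.card ι : ℤ) ≤ 2 * k - L := by
  have hsub {X : Finset ι} (hX : W.IsQualified X) : (Fintype.card ι : ℤ) - X.card ≤ k - L := by
    have := hforbidden _ hX.isForbidden_compl
    rwa [Finset.card_compl, Nat.cast_sub X.card_le_univ] at this
  obtain hk | hk := le_total k (Fintype.card ι)
  · obtain ⟨X, -, hX⟩ := Finset.exists_subset_card_eq (hk.trans_eq Finset.card_univ.symm)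
    linarith [hsub (hqualified X hX.ge), congrArg (Nat.cast (R := ℤ)) hX]
  · have huniv := hsub W.isQualified_univ
    rw [Finset.card_univ, sub_self] at huniv
    linarith [Nat.cast_le (α := ℤ).2 hk]

theorem IsPureStateScheme.two_mul_sub_le_card (hpure : W.IsPureStateScheme) {k L : ℕ}
    (hforbidden : ∀ X : Finset ι, (X.card : ℤ) ≤ k - L → W.IsForbidden X)
    (hqualified : ∀ X, W.IsQualified X → k ≤ X.card) :
    2 * (k : ℤ) - L ≤ Fintype.card ι := by
  have hk : k ≤ Fintype.card ι := by simpa using hqualified _ W.isQualified_univ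
  obtain rfl | ⟨m, rfl⟩ : k = 0 ∨ ∃ m, k = m + 1 := by cases k <;> simp
  · omega
  obtain ⟨X, -, hX⟩ := Finset.exists_subset_card_eq
    ((Nat.le_of_succ_le hk).trans_eq Finset.card_univ.symm)
  have hnot : ¬ (Xᶜ.card : ℤ) ≤ (m + 1 : ℕ) - L := fun h => by
    have := hqualified X (hpure.isQualified_of_isForbidden_compl (hforbidden _ h))
    omega
  rw [Finset.card_compl] at hnot
  omega

end QSSScheme

end Shares

end RampQSS

theorem lemma2_general {k L : ℕ} {d : Type*} [Fintype d] [DecidableEq d] [Nonempty d]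
    {ι : Type*} [Fintype ι] [DecidableEq ι] {κ : ι → Type*} [∀ i, Fintype (κ i)]
    [∀ i, DecidableEq (κ i)] (W : RampQSS.QSSScheme d κ) (hW : W.IsThresholdRamp k L) :
    (Fintype.card ι : ℤ) ≤ 2 * (k : ℤ) - (L : ℤ) ∧
      (W.IsPureStateScheme → (Fintype.card ι : ℤ) = 2 * (k : ℤ) - (L : ℤ)) := by
  have hle := W.card_le_two_mul_sub (fun X => (hW.1 X).1) fun X => (hW.2 X).2
  exact ⟨hle, fun hpure => hle.antisymm <|
    hpure.two_mul_sub_le_card (fun X => (hW.1 X).2) fun X => (hW.2 X).1⟩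

theorem lemma2 {k L n : ℕ} {d : Type*} [Fintype d] [DecidableEq d] [Nonempty d]
    {κ : Fin n → Type*} [∀ i, Fintype (κ i)] [∀ i, DecidableEq (κ i)]
    (W : RampQSS.QSSScheme d κ) (hW : W.IsThresholdRamp k L) :
    (n : ℤ) ≤ 2 * (k : ℤ) - (L : ℤ) ∧
      (W.IsPureStateScheme → (n : ℤ) = 2 * (k : ℤ) - (L : ℤ)) := by
  simpa using lemma2_general W hW
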